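/- Let $G$ be a countably infinite discrete group and let $G^\flat$ be a finite-index subgroup of $G$. Then $G$ has property SC if and only if $G^\flat$ has property SC. Here, for a countably infinite group $\Gamma$, write $\mathcal F(\Gamma)$ for the set of nonempty finite subsets of $\Gamma$ and $\overline{\mathcal F}(\Gamma)$ for the set of finite subsets $S$ of $\Gamma$ with $e\in S$ and $S=S^{-1}$. A free p.m.p. action $\Gamma\curvearrowright(X,\mu)$ is an action by measure-preserving Borel transformations on a standard Borel space $X$ with a Borel probability measure $\mu$, such that for $\mu$-almost every $x$ one has $gx\neq x$ for all $g\in\Gamma\setminus\{e\}$. For $S\subseteq\Gamma$, an $S$-edge is a pair $(x,y)$ of points of $X$ with $y=gx$ for some $g\in S$; a path of length $l\ge 0$ connecting $x_0$ and $x_l$ is a tuple $(x_0,\dots,x_l)$ of points of $X$, with edges $(x_{i-1},x_i)$ for $1\le i\le l$. The group $\Gamma$ has property SC if for every function $\Upsilon:\mathcal F(\Gamma)\to[0,\infty)$ there exists $S\in\overline{\mathcal F}(\Gamma)$ such that for every $T\in\overline{\mathcal F}(\Gamma)$ there are $C,n\in\mathbb N$ and $S_1,\dots,S_n\in\overline{\mathcal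 F}(\Gamma)$ such that for every free p.m.p. action $\Gamma\curvearrowright(X,\mu)$ there are Borel sets $W,\mathcal V_1,\dots,\mathcal V_n\subseteq X$ satisfying: 1. $\sum_{j=1}^n\Upsilon(S_j)\,\mu(\mathcal V_j)\le 1$; 2. $SW=X$; 3. if $w_1,w_2\in W$ satisfy $gw_1=w_2$ for some $g\in T$, then $w_1$ and $w_2$ are connected by a path of length at most $C$ in which each edge is, for some $1\le j\le n$, an $S_j$-edge with both endpoints in $\mathcal V_j$. -/

import Mathlib

open MeasureTheory
open scoped NNReal ENNReal Pointwise

universe u v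

/-- A free p.m.p. action of `G`: an action of `G` on a standard probability space `(X, μ)` by
measurable measure-preserving transformations such that, for almost every `x`, no nontrivial
element of `G` fixes `x`. -/
structure FreePMPAction (G : Type u) [Group G] where
  /-- the underlying space -/
  X : Type v
  [measurableSpace : MeasurableSpace X]
  [standardBorel : StandardBorelSpace X]
  /-- the invariant measure -/
  μ : Measure X
  [isProbabilityMeasure : IsProbabilityMeasure μ]
  [mulAction : MulAction G X]
  measurePreserving : ∀ g : G, MeasurePreserving (fun x : X => g • x) μ μ
  free : ∀ᵐ x ∂μ, ∀ g : G, g ≠ 1 → g • x ≠ x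

attribute [instance] FreePMPAction.measurableSpace FreePMPAction.standardBorel
  FreePMPAction.isProbabilityMeasure FreePMPAction.mulAction

/-- The nonempty finite subsets of `G`. -/
abbrev FiniteSets (G : Type u) : Type u := {F : Finset G // F.Nonempty}

/-- The symmetric finite subsets of `G` containing the identity. -/
def SymmFiniteSets (G : Type u) [Group G] : Set (FiniteSets G) :=
  {F | 1 ∈ F.1 ∧ ∀ g ∈ F.1, g⁻¹ ∈ F.1}

/-- `x` and `y` form an `S`-edge: `y = g x` for some `g ∈ S`. -/
def IsSEdge {G : Type u} [Group G] {X : Type v} [MulAction G X]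
    (S : FiniteSets G) (x y : X) : Prop :=
  ∃ g ∈ S.1, y = g • x

/-- `x` and `y` are connected by a path of length at most `C` in which each edge is an
`S j`-edge with both endpoints in `V j` for some `j`. -/
def SparselyConnected {G : Type u} [Group G] {X : Type v} [MulAction G X] {n : ℕ}
    (S : Fin n → FiniteSets G) (V : Fin n → Set X) (C : ℕ) (x y : X) : Prop :=
  ∃ (l : ℕ) (p : Fin (l + 1) → X), l ≤ C ∧ p 0 = x ∧ p (Fin.last l) = y ∧
    ∀ i : Fin l, ∃ j : Fin n,
      IsSEdge (S j) (p i.castSucc) (p i.succ) ∧ p i.castSucc ∈ V j ∧ p i.succ ∈ V j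

/-- Property SC for a class `𝒴` of free p.m.p. actions of `G`. -/
def ClassHasSC {G : Type u} [Group G] (𝒴 : Set (FreePMPAction.{u, v} G)) : Prop :=
  ∀ Υ : FiniteSets G → ℝ≥0,
    ∃ S ∈ SymmFiniteSets G, ∀ T ∈ SymmFiniteSets G,
      ∃ (C n : ℕ) (Sj : Fin n → FiniteSets G), (∀ j, Sj j ∈ SymmFiniteSets G) ∧
        ∀ a ∈ 𝒴, ∃ (W : Set a.X) (V : Fin n → Set a.X),
          MeasurableSet W ∧ (∀ j, MeasurableSet (V j)) ∧
          (∑ j, (Υ (Sj j) : ℝ≥0∞) * a.μ (V j)) ≤ 1 ∧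
          (S.1 : Set G) • W = Set.univ ∧
          ∀ w₁ ∈ W, ∀ w₂ ∈ W, (∃ g ∈ T.1, g • w₁ = w₂) →
            SparselyConnected Sj V C w₁ w₂

/-- Property SC for the group `G`: the class of all free p.m.p. actions of `G` has it. -/
def PropertySC (G : Type u) [Group G] : Prop :=
  ClassHasSC (Set.univ : Set (FreePMPAction.{u, v} G))

/-! Both implications transport actions. From `G` to `H`, an `H`-action is induced to `G` on
finitely many copies of the space; the sets found there are projected back, and the cocycle of the
induction turns `G`-edges into `H`-edges with labels in a finite set fixed in advance.

From `H` to `G`, a `G`-action is restricted to `H`. A `T`-edge between points of `W` may leave the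
`H`-orbit, so one extra set provides bridges between `H`-orbits: a bounded neighbourhood of a marker
set `Z` (`exists_uniform_markers`). From either end, an `H`-path leads to a point of `W` near a
common marker, and one edge of a finite set `Q` joins those two points. Since `Q` depends only on
`S` and coset representatives, `Z` can be made small enough to pay for `Q`; only then is the finite
set `T'` handed to `H` chosen, large enough to reach the markers. -/

open scoped Classical in
/-- The smallest symmetric finite set containing `A` and the identity. -/
noncomputable def symmHull {G : Type u} [Group G] (A : Finset G) : FiniteSets G :=
  ⟨insert 1 (A ∪ A⁻¹), Finset.insert_nonempty _ _⟩

lemma symmHull_mem {G : Type u} [Group G] (A : Finset G) : symmHull A ∈ SymmFiniteSets G := by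
  classical
  refine ⟨by simp [symmHull], fun g hg => ?_⟩
  simp only [symmHull, Finset.mem_insert, Finset.mem_union, Finset.mem_inv'] at hg ⊢
  rcases hg with rfl | h | h
  · simp
  · simp [h]
  · simp [h]

lemma subset_symmHull {G : Type u} [Group G] {A : Finset G} {g : G} (hg : g ∈ A) :
    g ∈ (symmHull A).1 := by
  classical
  simp [symmHull, hg]

/-- The edge relation underlying `SparselyConnected`. -/
def SparseEdge {G : Type u} [Group G] {X : Type v} [MulAction G X] {n : ℕ}
    (S : Fin n → FiniteSets G) (V : Fin n → Set X) (x y : X) : Prop :=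
  ∃ j : Fin n, IsSEdge (S j) x y ∧ x ∈ V j ∧ y ∈ V j

/-! ### Concatenating and transporting paths -/

section Paths

variable {G : Type u} [Group G] {X : Type v} [MulAction G X] {n : ℕ}
  {S : Fin n → FiniteSets G} {V : Fin n → Set X} {C D : ℕ} {x y z : X}

lemma sparselyConnected_iff_nat :
    SparselyConnected S V C x y ↔ ∃ (l : ℕ) (p : ℕ → X), l ≤ C ∧ p 0 = x ∧ p l = y ∧
      ∀ i < l, SparseEdge S V (p i) (p (i + 1)) := by
  constructor
  · rintro ⟨l, p, hl, h0, h1, h⟩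
    refine ⟨l, fun i => p ⟨min i l, by omega⟩, hl, ?_, ?_, fun i hi => ?_⟩
    · simpa using h0
    · simpa [Fin.last] using h1
    · have := h ⟨i, hi⟩
      have e1 : min i l = i := by omega
      have e2 : min (i + 1) l = i + 1 := by omega
      simpa [SparseEdge, e1, e2] using this
  · rintro ⟨l, p, hl, h0, h1, h⟩
    exact ⟨l, fun i => p i, hl, by simpa using h0, by simpa using h1,
      fun i => by simpa [SparseEdge] using h i i.2⟩

lemma SparselyConnected.trans (h : SparselyConnected S V C x y)
    (h' : SparselyConnected S V D y z) : SparselyConnected S V (C + D) x z := by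
  rw [sparselyConnected_iff_nat] at *
  obtain ⟨l, p, hl, h0, h1, h⟩ := h
  obtain ⟨k, q, hk, k0, k1, h'⟩ := h'
  refine ⟨l + k, fun i => if i ≤ l then p i else q (i - l), by omega, by simpa using h0, ?_,
    fun i hi => ?_⟩
  · by_cases hk0 : k = 0
    · subst hk0
      simp [h1, ← k1, k0]
    · simp [hk0, k1]
  · rcases lt_trichotomy i l with hil | rfl | hil
    · have : i + 1 ≤ l := hil
      simpa [hil.le, this] using h i hil
    · have := h' 0 (by omega)
      simpa [h1, ← k0] using this
    · have := h' (i - l) (by omega)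
      have e : i - l + 1 = i + 1 - l := by omega
      rw [e] at this
      simpa [not_le.2 hil, not_le.2 (Nat.lt_succ_of_lt hil)] using this

lemma SparseEdge.sparselyConnected (h : SparseEdge S V x y) : SparselyConnected S V 1 x y := by
  rw [sparselyConnected_iff_nat]
  refine ⟨1, fun i => if i = 0 then x else y, le_rfl, by simp, by simp, fun i hi => ?_⟩
  obtain rfl : i = 0 := by omega
  simpa using h

lemma SparselyConnected.map {G' : Type*} [Group G'] {X' : Type*} [MulAction G' X'] {n' : ℕ}
    {S' : Fin n' → FiniteSets G'} {V' : Fin n' → Set X'} (f : X → X')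
    (hf : ∀ x y, SparseEdge S V x y → SparseEdge S' V' (f x) (f y))
    (h : SparselyConnected S V C x y) : SparselyConnected S' V' C (f x) (f y) := by
  obtain ⟨l, p, hl, h0, h1, h⟩ := h
  exact ⟨l, f ∘ p, hl, congrArg f h0, congrArg f h1, fun i => hf _ _ (h i)⟩

end Paths

/-! ### Sparse measurable marker sets -/

section Markers

variable {X : Type v} [MeasurableSpace X]

/-- In a countably separated measurable space, a point can be separated from finitely many others
by one of countably many measurable sets. -/
lemma exists_measurableSet_seq_separating_finset [MeasurableSpace.CountablySeparated X] :
    ∃ A : ℕ → Set X, (∀ k, MeasurableSet (A k)) ∧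
      ∀ (x : X) (F : Finset X), x ∉ F → ∃ k, x ∈ A k ∧ ∀ y ∈ F, y ∉ A k := by
  classical
  obtain ⟨f, hf, hinj⟩ := MeasurableSpace.measurable_injection_nat_bool_of_countablySeparated X
  obtain ⟨b, hb⟩ := TopologicalSpace.exists_countable_basis (ℕ → Bool)
  obtain ⟨s, hs⟩ := hb.1.exists_eq_range
    ((hb.2.2.exists_subset_of_mem_open (Set.mem_univ fun _ => false) isOpen_univ).imp
      fun _ h => h.1)
  refine ⟨fun k => f ⁻¹' s k, fun k => hf (hb.2.2.isOpen (hs ▸ ⟨k, rfl⟩)).measurableSet,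
    fun x F hx => ?_⟩
  have hopen : IsOpen ((F.image f : Finset (ℕ → Bool)) : Set (ℕ → Bool))ᶜ :=
    (Finset.finite_toSet _).isClosed.isOpen_compl
  have hmem : f x ∈ ((F.image f : Finset (ℕ → Bool)) : Set (ℕ → Bool))ᶜ := by
    simp only [Set.mem_compl_iff, Finset.mem_coe, Finset.mem_image, not_exists, not_and]
    intro y hy h
    exact hx (hinj h ▸ hy)
  obtain ⟨t, ht, hxt, hsub⟩ := hb.2.2.exists_subset_of_mem_open hmem hopen
  rw [hs] at ht
  obtain ⟨k, rfl⟩ := ht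
  refine ⟨k, hxt, fun y hy hyk => hsub hyk ?_⟩
  exact Finset.mem_coe.2 (Finset.mem_image_of_mem f hy)

variable {H : Type u} [Group H] [MulAction H X]

/-- A symmetric finite set `D` of group elements acting without fixed points on `Y` has a
measurable maximal independent set in `Y`. -/
lemma exists_measurableSet_maximal_independent [MeasurableSpace.CountablySeparated X]
    (hH : ∀ g : H, Measurable fun x : X => g • x)
    (D : Finset H) (hD : ∀ g ∈ D, g⁻¹ ∈ D) {Y : Set X} (hY : MeasurableSet Y)
    (hfree : ∀ x ∈ Y, ∀ g ∈ D, g • x ≠ x) :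
    ∃ Z ⊆ Y, MeasurableSet Z ∧ (∀ x ∈ Z, ∀ g ∈ D, g • x ∉ Z) ∧
      ∀ x ∈ Y, x ∈ Z ∨ ∃ g ∈ D, g • x ∈ Z := by
  classical
  obtain ⟨A, hA, hsep⟩ := exists_measurableSet_seq_separating_finset (X := X)
  -- Each `B k` is independent and together they cover `Y`. Going through them greedily, a point of
  -- `B k` is rejected only if a `D`-neighbour was already chosen.
  let B : ℕ → Set X := fun k => {x | x ∈ Y ∧ x ∈ A k ∧ ∀ g ∈ D, g • x ∉ A k}
  have hB : ∀ k, MeasurableSet (B k) := by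
    intro k
    have : B k = Y ∩ (A k ∩ ⋂ g ∈ D, (fun x => g • x) ⁻¹' (A k)ᶜ) := by
      ext x; simp [B]; grind
    rw [this]
    exact hY.inter ((hA k).inter (D.measurableSet_biInter fun g _ => hH g (hA k).compl))
  let step : Set X → Set X → Set X := fun b z => z ∪ {x | x ∈ b ∧ ∀ g ∈ D, g • x ∉ z}
  let Z : ℕ → Set X := fun k => Nat.rec ∅ (fun k z => step (B k) z) k
  have hZs : ∀ k, Z (k + 1) = step (B k) (Z k) := fun k => rfl
  have hZmeas : ∀ k, MeasurableSet (Z k) := by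
    intro k
    induction k with
    | zero => exact MeasurableSet.empty
    | succ k ih =>
      have : Z (k + 1) = Z k ∪ (B k ∩ ⋂ g ∈ D, (fun x => g • x) ⁻¹' (Z k)ᶜ) := by
        rw [hZs]; ext x; simp [step]
      rw [this]
      exact ih.union ((hB k).inter (D.measurableSet_biInter fun g _ => hH g ih.compl))
  have hmono : Monotone Z := monotone_nat_of_le_succ fun k => by
    rw [hZs]; exact Set.subset_union_left
  have hZY : ∀ k, Z k ⊆ Y := by
    intro k
    induction k with
    | zero => exact Set.empty_subset _
    | succ k ih =>
      rw [hZs]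
      exact Set.union_subset ih fun x hx => hx.1.1
  have hind : ∀ k, ∀ x ∈ Z k, ∀ g ∈ D, g • x ∉ Z k := by
    intro k
    induction k with
    | zero => intro x hx; exact hx.elim
    | succ k ih =>
      intro x hx g hg hgx
      rw [hZs] at hx hgx
      rcases hx with hx | hx <;> rcases hgx with hgx | hgx
      · exact ih x hx g hg hgx
      · exact hgx.2 g⁻¹ (hD g hg) (by simpa using hx)
      · exact hx.2 g hg hgx
      · exact hx.1.2.2 g hg hgx.1.2.1
  refine ⟨⋃ k, Z k, Set.iUnion_subset hZY, MeasurableSet.iUnion hZmeas, ?_, ?_⟩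
  · intro x hx g hg hgx
    obtain ⟨i, hi⟩ := Set.mem_iUnion.1 hx
    obtain ⟨j, hj⟩ := Set.mem_iUnion.1 hgx
    exact hind (max i j) x (hmono (le_max_left i j) hi) g hg (hmono (le_max_right i j) hj)
  · intro x hx
    obtain ⟨k, hxk, hk⟩ := hsep x (D.image fun g => g • x) (by
      simpa only [Finset.mem_image, not_exists, not_and] using hfree x hx)
    rcases em (∃ g ∈ D, g • x ∈ Z k) with ⟨g, hg, hgx⟩ | h
    · exact Or.inr ⟨g, hg, Set.mem_iUnion.2 ⟨k, hgx⟩⟩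
    · push Not at h
      refine Or.inl (Set.mem_iUnion.2 ⟨k + 1, ?_⟩)
      rw [hZs]
      exact Or.inr ⟨⟨hx, hxk, fun g hg => hk _ (Finset.mem_image_of_mem _ hg)⟩, h⟩

end Markers

/-- Uniform marker lemma: for every `ε > 0` there is a finite set `F` such that every free p.m.p.
action has a measurable set of measure at most `ε` whose `F`-translates cover the space. -/
lemma exists_uniform_markers (H : Type u) [Group H] [Infinite H] (ε : ℝ≥0∞) (hε : ε ≠ 0) :
    ∃ F : Finset H, ∀ a : FreePMPAction.{u, v} H, ∃ Z : Set a.X, MeasurableSet Z ∧ a.μ Z ≤ ε ∧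
      ∀ x : a.X, ∃ g ∈ F, ∃ z ∈ Z, x = g • z := by
  classical
  obtain ⟨N, hN⟩ := ENNReal.exists_inv_nat_lt hε
  obtain ⟨E, hE⟩ := Infinite.exists_subset_card_eq H N
  -- `D`-independence makes the `N` translates of `Z` by `E` disjoint, so `Z` has measure at most `1
  -- / N`.
  let D : Finset H := (E⁻¹ * E).erase 1
  have hD : ∀ g ∈ D, g⁻¹ ∈ D := by
    intro g hg
    obtain ⟨h1, hg⟩ := Finset.mem_erase.1 hg
    obtain ⟨a, ha, b, hb, rfl⟩ := Finset.mem_mul.1 hg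
    refine Finset.mem_erase.2 ⟨inv_ne_one.2 h1, Finset.mem_mul.2 ⟨b⁻¹, ?_, a⁻¹, ?_, by simp⟩⟩
    · simpa using hb
    · simpa using ha
  refine ⟨insert 1 D, fun a => ?_⟩
  have hmeas : ∀ g : H, Measurable fun x : a.X => g • x := fun g => (a.measurePreserving g).measurable
  let Y : Set a.X := ⋂ g ∈ D, {x | g • x = x}ᶜ
  have hY : MeasurableSet Y :=
    D.measurableSet_biInter fun g _ => (measurableSet_eq_fun (hmeas g) measurable_id).compl
  have hYc : a.μ Yᶜ = 0 := by
    have : ∀ᵐ x ∂a.μ, x ∈ Y := by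
      filter_upwards [a.free] with x hx
      exact Set.mem_iInter₂.2 fun g hg => hx g (Finset.mem_erase.1 hg).1
    exact this
  obtain ⟨Z, hZY, hZ, hind, hmax⟩ := exists_measurableSet_maximal_independent hmeas D hD hY
    fun x hx g hg => Set.mem_iInter₂.1 hx g hg
  -- Freeness holds only almost everywhere; adding the null set `Yᶜ` makes the covering hold at
  -- every point.
  refine ⟨Z ∪ Yᶜ, hZ.union hY.compl, ?_, ?_⟩
  · have hμ : ∀ g : H, a.μ ((fun x => g⁻¹ • x) ⁻¹' Z) = a.μ Z := fun g =>
      (a.measurePreserving g⁻¹).measure_preimage hZ.nullMeasurableSet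
    have hdisj : (E : Set H).PairwiseDisjoint fun g => (fun x : a.X => g⁻¹ • x) ⁻¹' Z := by
      intro g hg g' hg' hne
      refine Set.disjoint_left.2 fun x hx hx' => ?_
      refine hind _ hx (g'⁻¹ * g) ?_ ?_
      · refine Finset.mem_erase.2 ⟨fun h => hne ?_, Finset.mem_mul.2 ⟨g'⁻¹, ?_, g, hg, rfl⟩⟩
        · exact (inv_mul_eq_one.1 h).symm
        · simpa using hg'
      · simpa [mul_smul] using hx'
    have hsum : (N : ℝ≥0∞) * a.μ Z ≤ 1 := by
      have h := measure_biUnion_finset (μ := a.μ) hdisj fun g _ => hmeas g⁻¹ hZ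
      simp only [hμ, Finset.sum_const, hE, nsmul_eq_mul] at h
      rw [← h]
      exact prob_le_one
    have : a.μ Z ≤ (N : ℝ≥0∞)⁻¹ := by
      rw [ENNReal.le_inv_iff_mul_le, mul_comm]
      exact hsum
    calc a.μ (Z ∪ Yᶜ) ≤ a.μ Z + a.μ Yᶜ := measure_union_le _ _
      _ ≤ ε := by rw [hYc, add_zero]; exact this.trans hN.le
  · intro x
    by_cases hx : x ∈ Y
    · rcases hmax x hx with h | ⟨g, hg, h⟩
      · exact ⟨1, by simp, x, Or.inl h, by simp⟩
      · exact ⟨g⁻¹, Finset.mem_insert_of_mem (hD g hg), g • x, Or.inl h, by simp⟩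
    · exact ⟨1, by simp, x, Or.inr hx, by simp⟩

/-! ### From the subgroup to the group, by restriction -/

section Restriction

variable {G : Type u} [Group G] (H : Subgroup G)

/-- The restriction of a free p.m.p. action to a subgroup. -/
def FreePMPAction.restrict (a : FreePMPAction.{u, v} G) : FreePMPAction.{u, v} H where
  X := a.X
  μ := a.μ
  mulAction := inferInstance
  measurePreserving g := a.measurePreserving g
  free := by
    filter_upwards [a.free] with x hx g hg
    exact hx g (by simpa using hg)

/-- A finite subset of a subgroup, regarded as a subset of the ambient group. -/
def FiniteSets.ofSubgroup (F : FiniteSets H) : FiniteSets G :=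
  ⟨F.1.map ⟨Subtype.val, Subtype.val_injective⟩, F.2.map⟩

variable {H}

lemma FiniteSets.mem_ofSubgroup {F : FiniteSets H} {g : G} :
    g ∈ (F.ofSubgroup H).1 ↔ ∃ h ∈ F.1, (h : G) = g := by
  simp [FiniteSets.ofSubgroup]

lemma FiniteSets.ofSubgroup_mem {F : FiniteSets H} (hF : F ∈ SymmFiniteSets H) :
    F.ofSubgroup H ∈ SymmFiniteSets G := by
  refine ⟨FiniteSets.mem_ofSubgroup.2 ⟨1, hF.1, rfl⟩, fun g hg => ?_⟩
  obtain ⟨h, hh, rfl⟩ := FiniteSets.mem_ofSubgroup.1 hg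
  exact FiniteSets.mem_ofSubgroup.2 ⟨h⁻¹, hF.2 h hh, rfl⟩

variable (H) in
/-- A finite-index subgroup has a finite set of representatives of its right cosets. -/
lemma exists_finset_right_transversal [H.FiniteIndex] :
    ∃ R : Finset G, ∀ g : G, ∃ r ∈ R, g * r⁻¹ ∈ H := by
  classical
  have : Fintype (G ⧸ H) := Fintype.ofFinite _
  refine ⟨Finset.univ.image fun q : G ⧸ H => q.out⁻¹, fun g => ⟨_, Finset.mem_image_of_mem _
    (Finset.mem_univ ((g⁻¹ : G) : G ⧸ H)), ?_⟩⟩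
  have : (((g⁻¹ : G) : G ⧸ H).out : G ⧸ H) = ((g⁻¹ : G) : G ⧸ H) := QuotientGroup.out_eq' _
  have := QuotientGroup.eq.1 this.symm
  simpa using this

lemma measure_biUnion_smul_le (a : FreePMPAction.{u, v} G) (Q : Finset G) {Z : Set a.X}
    (hZ : MeasurableSet Z) :
    MeasurableSet (⋃ g ∈ Q, (fun x : a.X => g⁻¹ • x) ⁻¹' Z) ∧
      a.μ (⋃ g ∈ Q, (fun x : a.X => g⁻¹ • x) ⁻¹' Z) ≤ Q.card * a.μ Z := by
  refine ⟨Q.measurableSet_biUnion fun g _ => (a.measurePreserving g⁻¹).measurable hZ, ?_⟩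
  calc _ ≤ ∑ g ∈ Q, a.μ ((fun x : a.X => g⁻¹ • x) ⁻¹' Z) := measure_biUnion_finset_le _ _
    _ = Q.card * a.μ Z := by
      simp [fun g : G => (a.measurePreserving g⁻¹).measure_preimage hZ.nullMeasurableSet]

theorem PropertySC.of_finiteIndex_subgroup [Infinite G] [H.FiniteIndex]
    (hSC : PropertySC.{u, v} H) : PropertySC.{u, v} G := by
  classical
  intro Υ
  have : Infinite H := by
    have h := H.card_mul_index
    rw [Nat.card_eq_zero_of_infinite (α := G)] at h
    have h0 := (mul_eq_zero.1 h).resolve_right Subgroup.FiniteIndex.index_ne_zero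
    exact (Nat.card_eq_zero.1 h0).resolve_left (not_isEmpty_iff.2 inferInstance)
  obtain ⟨R, hR⟩ := exists_finset_right_transversal H
  -- The factor 2 reserves half of the budget for the bridging set.
  obtain ⟨S, hS, hSC⟩ := hSC fun F => 2 * Υ (F.ofSubgroup H)
  have hSG := FiniteSets.ofSubgroup_mem hS
  refine ⟨S.ofSubgroup H, hSG, fun T hT => ?_⟩
  set SG := (S.ofSubgroup H).1
  -- `SG * R` contains the label of the bridging edge; `SG` and `SG * R * SG` put its two endpoints
  -- in the `Q`-neighbourhood of `Z`.
  let Q : FiniteSets G := symmHull (SG ∪ SG * R ∪ SG * R * SG)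
  -- If `Υ Q = 0` this is `∞`, which is harmless.
  let ε : ℝ≥0∞ := (2 * Υ Q * Q.1.card)⁻¹
  have hε : ε ≠ 0 := ENNReal.inv_ne_zero.2 (by finiteness)
  obtain ⟨F, hF⟩ := exists_uniform_markers.{u, v} H ε hε
  let FG : Finset G := F.map ⟨Subtype.val, Subtype.val_injective⟩
  -- These are the elements `f * s` and `g * f * s * r⁻¹ * s'` that carry the bridge's endpoints
  -- `w`, `w'` to `w₁` and `g • w₁`.
  let T' : FiniteSets H := symmHull (((FG * SG) ∪ T.1 * FG * SG * R⁻¹ * SG).subtype (· ∈ H))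
  obtain ⟨C, n, Sj, hSj, hSC⟩ := hSC T' (symmHull_mem _)
  refine ⟨C + 1 + C, n + 1, Fin.cons Q fun j => (Sj j).ofSubgroup H, fun j => ?_, fun a _ => ?_⟩
  · refine Fin.cases ?_ (fun j => ?_) j
    · exact symmHull_mem _
    · exact FiniteSets.ofSubgroup_mem (hSj j)
  obtain ⟨W, V, hW, hV, hsum, hcov, hconn⟩ := hSC (a.restrict H) (Set.mem_univ _)
  obtain ⟨Z, hZ, hZε, hFZ⟩ := hF (a.restrict H)
  change Set a.X at W Z
  change Fin n → Set a.X at V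
  let QZ : Set a.X := ⋃ g ∈ Q.1, (fun x : a.X => g⁻¹ • x) ⁻¹' Z
  obtain ⟨hQZ, hμQZ⟩ := measure_biUnion_smul_le a Q.1 hZ
  have hcov' : ∀ x : a.X, ∃ s ∈ S.1, ∃ w ∈ W, (s : G) • w = x := fun x => by
    have : (x : (a.restrict H).X) ∈ (S.1 : Set H) • W := hcov ▸ Set.mem_univ x
    obtain ⟨s, hs, w, hw, h⟩ := Set.mem_smul.1 this
    exact ⟨s, hs, w, hw, h⟩
  have memSG : ∀ {s : H}, s ∈ S.1 → (s : G) ∈ SG := fun hs =>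
    FiniteSets.mem_ofSubgroup.2 ⟨_, hs, rfl⟩
  have lift : ∀ w₁ ∈ W, ∀ w₂ ∈ W, ∀ g : G, g ∈ H → g ∈ (FG * SG) ∪ T.1 * FG * SG * R⁻¹ * SG →
      g • w₁ = w₂ → SparselyConnected (X := a.X) (Fin.cons Q fun j => (Sj j).ofSubgroup H)
        (Fin.cons QZ V : Fin (n + 1) → Set a.X) C w₁ w₂ ∧
        SparselyConnected (X := a.X) (Fin.cons Q fun j => (Sj j).ofSubgroup H)
        (Fin.cons QZ V : Fin (n + 1) → Set a.X) C w₂ w₁ := by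
    intro w₁ hw₁ w₂ hw₂ g hg hgm hgw
    have hgT : (⟨g, hg⟩ : H) ∈ T'.1 := subset_symmHull (Finset.mem_subtype.2 hgm)
    have hedge : ∀ x y : a.X, SparseEdge (X := (a.restrict H).X) Sj V x y →
        SparseEdge (X := a.X) (Fin.cons Q fun j => (Sj j).ofSubgroup H)
          (Fin.cons QZ V : Fin (n + 1) → Set a.X) x y := by
      rintro x y ⟨j, ⟨h, hh, hy⟩, hx, hyV⟩
      exact ⟨j.succ, ⟨h, FiniteSets.mem_ofSubgroup.2 ⟨h, hh, rfl⟩, hy⟩, hx, hyV⟩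
    constructor
    · exact (hconn w₁ hw₁ w₂ hw₂ ⟨⟨g, hg⟩, hgT, hgw⟩).map (X := (a.restrict H).X) (X' := a.X) id hedge
    · refine (hconn w₂ hw₂ w₁ hw₁ ⟨⟨g, hg⟩⁻¹, (symmHull_mem _).2 _ hgT, ?_⟩).map
        (X := (a.restrict H).X) (X' := a.X) id hedge
      exact inv_smul_eq_iff.2 hgw.symm
  refine ⟨W, Fin.cons QZ V, hW, fun j => ?_, ?_, ?_, ?_⟩
  · exact Fin.cases hQZ hV j
  · rw [Fin.sum_univ_succ]
    simp only [Fin.cons_zero, Fin.cons_succ]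
    have h1 : (Υ Q : ℝ≥0∞) * a.μ QZ ≤ 2⁻¹ := by
      have h2 : (2 * Υ Q * Q.1.card : ℝ≥0∞) * a.μ Z ≤ 1 :=
        (mul_le_mul_right hZε _).trans (ENNReal.mul_inv_le_one _)
      rw [ENNReal.le_inv_iff_mul_le]
      calc (Υ Q : ℝ≥0∞) * a.μ QZ * 2 ≤ Υ Q * (Q.1.card * a.μ Z) * 2 := by gcongr
        _ = 2 * Υ Q * Q.1.card * a.μ Z := by ring
        _ ≤ 1 := h2
    have h2 : ∑ j, (Υ ((Sj j).ofSubgroup H) : ℝ≥0∞) * a.μ (V j) ≤ 2⁻¹ := by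
      rw [ENNReal.le_inv_iff_mul_le, Finset.sum_mul]
      refine le_trans (le_of_eq ?_) hsum
      refine Finset.sum_congr rfl fun j _ => ?_
      push_cast
      change _ = 2 * _ * a.μ (V j)
      ring
    exact (add_le_add h1 h2).trans (ENNReal.inv_two_add_inv_two).le
  · refine Set.eq_univ_of_forall fun x => ?_
    obtain ⟨s, hs, w, hw, rfl⟩ := hcov' x
    exact Set.smul_mem_smul (memSG hs) hw
  · rintro w₁ hw₁ w₂ hw₂ ⟨g, hg, rfl⟩
    change a.X at w₁
    change g • w₁ ∈ W at hw₂
    obtain ⟨f, hf, z, hz, hfz⟩ := hFZ w₁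
    change a.X at z
    change w₁ = (f : G) • z at hfz
    obtain ⟨s, hs, w, hw, rfl⟩ := hcov' z
    -- This choice of `r` puts `r • w` in the `H`-orbit of `g • w₁`.
    obtain ⟨r, hr, hrH⟩ := hR (g * f * s)
    obtain ⟨s', hs', w', hw', hsw'⟩ := hcov' (r • w)
    have hfG : (f : G) ∈ FG := Finset.mem_map.2 ⟨f, hf, rfl⟩
    have c1 := (lift w hw w₁ hw₁ (f * s) (mul_mem f.2 s.2)
      (Finset.mem_union_left _ (Finset.mul_mem_mul hfG (memSG hs)))
      (by rw [hfz, mul_smul])).2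
    have c2 := (lift w' hw' (g • w₁) hw₂ (g * f * s * r⁻¹ * s') (mul_mem hrH s'.2)
      (Finset.mem_union_right _ (Finset.mul_mem_mul (Finset.mul_mem_mul (Finset.mul_mem_mul
        (Finset.mul_mem_mul hg hfG) (memSG hs)) (Finset.inv_mem_inv hr)) (memSG hs')))
      (by rw [hfz, mul_smul _ (s' : G), hsw']; simp [mul_smul])).1
    have hs1 : (s : G)⁻¹ ∈ SG := hSG.2 _ (memSG hs)
    have hs1' : (s' : G)⁻¹ ∈ SG := hSG.2 _ (memSG hs')
    have hw'eq : w' = ((s' : G)⁻¹ * r) • w := by rw [mul_smul, ← hsw', inv_smul_smul]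
    refine (c1.trans (SparseEdge.sparselyConnected ⟨0, ⟨(s' : G)⁻¹ * r, ?_, hw'eq⟩, ?_, ?_⟩)).trans
      c2
    · refine subset_symmHull ?_
      simp only [Finset.mem_union]
      exact Or.inl (Or.inr (Finset.mul_mem_mul hs1' hr))
    · refine Set.mem_iUnion₂.2 ⟨(s : G)⁻¹, subset_symmHull ?_, ?_⟩
      · simp only [Finset.mem_union]
        exact Or.inl (Or.inl hs1)
      · rw [Set.mem_preimage, inv_inv]
        exact hz
    · refine Set.mem_iUnion₂.2 ⟨(s' : G)⁻¹ * r * (s : G)⁻¹, subset_symmHull ?_, ?_⟩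
      · simp only [Finset.mem_union]
        exact Or.inr (Finset.mul_mem_mul (Finset.mul_mem_mul hs1' hr) hs1)
      · have : ((s' : G)⁻¹ * r * (s : G)⁻¹)⁻¹ • w' = (s : G) • w := by simp [hw'eq, mul_smul]
        rw [Set.mem_preimage, this]
        exact hz

end Restriction

/-! ### From the group to the subgroup, by induction of actions -/

section Induction

variable {G : Type u} [Group G] {H : Subgroup G} {m : ℕ} (e : Fin m ≃ G ⧸ H)

/-- The permutation action of `G` on an enumeration of the left cosets of `H`. -/
def cosetIndex (g : G) (i : Fin m) : Fin m := e.symm (g • e i)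

/-- The representative of the `i`-th left coset. -/
noncomputable def cosetRep (i : Fin m) : G := (e i).out

lemma coe_cosetRep (i : Fin m) : ((cosetRep e i : G) : G ⧸ H) = e i := QuotientGroup.out_eq' _

lemma cosetRep_inv_mul_mem (g : G) (i : Fin m) :
    (cosetRep e (cosetIndex e g i))⁻¹ * g * cosetRep e i ∈ H := by
  rw [mul_assoc, ← QuotientGroup.eq, coe_cosetRep, cosetIndex, Equiv.apply_symm_apply,
    ← coe_cosetRep e i]
  rfl

/-- The cocycle `G × G ⧸ H → H` determined by the coset representatives. -/
noncomputable def cosetCocycle (g : G) (i : Fin m) : H :=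
  ⟨(cosetRep e (cosetIndex e g i))⁻¹ * g * cosetRep e i, cosetRep_inv_mul_mem e g i⟩

lemma cosetIndex_one (i : Fin m) : cosetIndex e 1 i = i := by simp [cosetIndex]

lemma cosetIndex_mul (g h : G) (i : Fin m) :
    cosetIndex e (g * h) i = cosetIndex e g (cosetIndex e h i) := by
  simp [cosetIndex, mul_smul]

lemma cosetCocycle_one (i : Fin m) : cosetCocycle e 1 i = 1 := by
  ext
  simp [cosetCocycle, cosetIndex_one]

lemma cosetCocycle_mul (g h : G) (i : Fin m) :
    cosetCocycle e (g * h) i = cosetCocycle e g (cosetIndex e h i) * cosetCocycle e h i := by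
  ext
  simp [cosetCocycle, cosetIndex_mul, mul_assoc]

/-- Two points of the projected `W` may come from different copies `i` and `j`; this lifts an
`H`-move between them to a `G`-move. -/
lemma exists_cosetCocycle_eq (h : H) (i j : Fin m) :
    cosetIndex e (cosetRep e j * h * (cosetRep e i)⁻¹) i = j ∧
      cosetCocycle e (cosetRep e j * h * (cosetRep e i)⁻¹) i = h := by
  have hi : cosetIndex e (cosetRep e j * h * (cosetRep e i)⁻¹) i = j := by
    rw [cosetIndex, Equiv.symm_apply_eq, ← coe_cosetRep e i, ← coe_cosetRep e j]
    refine QuotientGroup.eq.2 ?_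
    simp
  refine ⟨hi, Subtype.ext ?_⟩
  simp only [cosetCocycle, hi]
  group

/-- The induced action of `G` on `G ⧸ H × X`, in terms of coset representatives. -/
@[reducible] noncomputable def inducedMulAction (X : Type v) [MulAction H X] :
    MulAction G (Fin m × X) where
  smul g p := (cosetIndex e g p.1, cosetCocycle e g p.1 • p.2)
  one_smul p := by
    change (cosetIndex e 1 p.1, cosetCocycle e 1 p.1 • p.2) = p
    rw [cosetIndex_one, cosetCocycle_one, one_smul]
  mul_smul g h p := by
    change (cosetIndex e (g * h) p.1, cosetCocycle e (g * h) p.1 • p.2) =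
      (cosetIndex e g (cosetIndex e h p.1),
        cosetCocycle e g (cosetIndex e h p.1) • cosetCocycle e h p.1 • p.2)
    rw [cosetIndex_mul, cosetCocycle_mul, mul_smul]

/-- The normalised product measure on `Fin m × X`. -/
noncomputable def inducedMeasure (m : ℕ) {X : Type v} [MeasurableSpace X] (μ : Measure X) :
    Measure (Fin m × X) :=
  (m : ℝ≥0∞)⁻¹ • ∑ i : Fin m, μ.map (Prod.mk i)

lemma inducedMeasure_apply {X : Type v} [MeasurableSpace X] (μ : Measure X) {A : Set (Fin m × X)}
    (hA : MeasurableSet A) :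
    inducedMeasure m μ A = (m : ℝ≥0∞)⁻¹ * ∑ i : Fin m, μ (Prod.mk i ⁻¹' A) := by
  simp [inducedMeasure, Measure.map_apply measurable_prodMk_left hA]

lemma cosetIndex_bijective (g : G) : Function.Bijective (cosetIndex e g) := by
  refine Function.bijective_iff_has_inverse.2 ⟨cosetIndex e g⁻¹, fun i => ?_, fun i => ?_⟩
  · rw [← cosetIndex_mul, inv_mul_cancel, cosetIndex_one]
  · rw [← cosetIndex_mul, mul_inv_cancel, cosetIndex_one]

/-- The free p.m.p. action of `G` induced from a free p.m.p. action of a finite-index subgroup. -/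
noncomputable def FreePMPAction.induced [NeZero m] (a : FreePMPAction.{u, v} H) :
    FreePMPAction.{u, v} G where
  X := Fin m × a.X
  μ := inducedMeasure m a.μ
  isProbabilityMeasure := ⟨by
    rw [inducedMeasure_apply _ MeasurableSet.univ]
    simp [ENNReal.inv_mul_cancel, NeZero.ne m]⟩
  mulAction := inducedMulAction e a.X
  measurePreserving g := by
    have hm : Measurable fun p : Fin m × a.X => (cosetIndex e g p.1, cosetCocycle e g p.1 • p.2) :=
      measurable_from_prod_countable_right fun i =>
        (measurable_const (a := cosetIndex e g i)).prodMk
          (a.measurePreserving (cosetCocycle e g i)).measurable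
    refine ⟨hm, Measure.ext fun A hA => ?_⟩
    change Measure.map (fun p : Fin m × a.X => (cosetIndex e g p.1, cosetCocycle e g p.1 • p.2))
      (inducedMeasure m a.μ) A = _
    rw [Measure.map_apply hm hA, inducedMeasure_apply _ hA, inducedMeasure_apply _ (hm hA)]
    congr 1
    refine Fintype.sum_bijective _ (cosetIndex_bijective e g) _ _ fun i => ?_
    exact (a.measurePreserving (cosetCocycle e g i)).measure_preimage
      (measurable_prodMk_left (x := cosetIndex e g i) hA).nullMeasurableSet
  free := by
    -- When `g` fixes the index, its cocycle value is a conjugate of `g`, so it is trivial only for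
    -- `g = 1`. A measurable hull is taken because `inducedMeasure_apply` needs measurability.
    let N : Set a.X := {x | ¬ ∀ h : H, h ≠ 1 → h • x ≠ x}
    have hN : a.μ (toMeasurable a.μ N) = 0 := by
      rw [measure_toMeasurable]
      exact a.free
    have hA : MeasurableSet (Prod.snd ⁻¹' toMeasurable a.μ N : Set (Fin m × a.X)) :=
      measurable_snd (measurableSet_toMeasurable _ _)
    refine measure_mono_null (t := Prod.snd ⁻¹' toMeasurable a.μ N) ?_ ?_
    · refine fun p hp => subset_toMeasurable a.μ N fun hfree => hp fun g hg hgp => hg ?_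
      have h1 : cosetIndex e g p.1 = p.1 := congrArg Prod.fst hgp
      have h2 : cosetCocycle e g p.1 • p.2 = p.2 := congrArg Prod.snd hgp
      have h3 : cosetCocycle e g p.1 = 1 := by_contra fun h => hfree _ h h2
      have h4 := congrArg Subtype.val h3
      simp only [cosetCocycle, h1, Subgroup.coe_one] at h4
      rw [mul_assoc, inv_mul_eq_one] at h4
      exact right_eq_mul.1 h4
    · rw [inducedMeasure_apply _ hA]
      have : ∀ i : Fin m, Prod.mk i ⁻¹' (Prod.snd ⁻¹' toMeasurable a.μ N) = toMeasurable a.μ N :=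
        fun i => rfl
      simp [this, hN]

open scoped Classical in
/-- The finite subset of `H` containing all values of the cocycle on a finite subset of `G`. -/
noncomputable def cosetContraction (F : FiniteSets G) : FiniteSets H :=
  ⟨insert 1 (((Finset.univ ×ˢ Finset.univ ×ˢ F.1).image fun p : Fin m × Fin m × G =>
    (cosetRep e p.1)⁻¹ * p.2.2 * cosetRep e p.2.1).subtype (· ∈ H)), Finset.insert_nonempty _ _⟩

lemma mem_cosetContraction {F : FiniteSets G} {h : H} :
    h ∈ (cosetContraction e F).1 ↔
      h = 1 ∨ ∃ i j, ∃ g ∈ F.1, (cosetRep e i)⁻¹ * g * cosetRep e j = h := by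
  classical
  simp [cosetContraction]

lemma cosetCocycle_mem_cosetContraction {F : FiniteSets G} {g : G} (hg : g ∈ F.1) (i : Fin m) :
    cosetCocycle e g i ∈ (cosetContraction e F).1 :=
  (mem_cosetContraction e).2 (Or.inr ⟨_, i, g, hg, rfl⟩)

lemma cosetContraction_mem {F : FiniteSets G} (hF : F ∈ SymmFiniteSets G) :
    cosetContraction e F ∈ SymmFiniteSets H := by
  refine ⟨(mem_cosetContraction e).2 (Or.inl rfl), fun h hh => (mem_cosetContraction e).2 ?_⟩
  rcases (mem_cosetContraction e).1 hh with rfl | ⟨i, j, g, hg, h'⟩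
  · simp
  · exact Or.inr ⟨j, i, g⁻¹, hF.2 g hg, by simp [← h', mul_assoc]⟩

theorem PropertySC.finiteIndex_subgroup (H : Subgroup G) [H.FiniteIndex]
    (hSC : PropertySC.{u, v} G) : PropertySC.{u, v} H := by
  classical
  let m := Nat.card (G ⧸ H)
  have : NeZero m := ⟨Nat.card_pos.ne'⟩
  let e : Fin m ≃ G ⧸ H := (Finite.equivFin (G ⧸ H)).symm
  intro Υ
  -- The factor `m` cancels the normalisation of the induced measure: a projection has measure at
  -- most `m` times that of the original set.
  obtain ⟨S, hS, hSC⟩ := hSC fun F => m * Υ (cosetContraction e F)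
  refine ⟨cosetContraction e S, cosetContraction_mem e hS, fun T hT => ?_⟩
  let T' : FiniteSets G := symmHull ((Finset.univ ×ˢ Finset.univ ×ˢ T.1).image
    fun p : Fin m × Fin m × H => cosetRep e p.1 * p.2.2 * (cosetRep e p.2.1)⁻¹)
  obtain ⟨C, n, Sj, hSj, hSC⟩ := hSC T' (symmHull_mem _)
  refine ⟨C, n, fun j => cosetContraction e (Sj j), fun j => cosetContraction_mem e (hSj j),
    fun a _ => ?_⟩
  obtain ⟨W, V, hW, hV, hsum, hcov, hconn⟩ := hSC (a.induced e) (Set.mem_univ _)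
  change Set (Fin m × a.X) at W
  change Fin n → Set (Fin m × a.X) at V
  refine ⟨⋃ i, Prod.mk i ⁻¹' W, fun j => ⋃ i, Prod.mk i ⁻¹' V j,
    MeasurableSet.iUnion fun i => measurable_prodMk_left hW,
    fun j => MeasurableSet.iUnion fun i => measurable_prodMk_left (hV j), ?_, ?_, ?_⟩
  · refine (Finset.sum_le_sum fun j _ => ?_).trans hsum
    change _ ≤ _ * inducedMeasure m a.μ (V j)
    rw [inducedMeasure_apply _ (hV j)]
    have hm : (m : ℝ≥0∞) * (m : ℝ≥0∞)⁻¹ = 1 :=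
      ENNReal.mul_inv_cancel (by exact_mod_cast NeZero.ne m) (by finiteness)
    calc (Υ (cosetContraction e (Sj j)) : ℝ≥0∞) * a.μ (⋃ i, Prod.mk i ⁻¹' V j)
        ≤ Υ (cosetContraction e (Sj j)) * ∑ i, a.μ (Prod.mk i ⁻¹' V j) := by
          gcongr
          exact measure_iUnion_fintype_le _ _
      _ = (m * (m : ℝ≥0∞)⁻¹) * (Υ (cosetContraction e (Sj j)) *
            ∑ i, a.μ (Prod.mk i ⁻¹' V j)) := by rw [hm, one_mul]
      _ = _ := by push_cast; ring
  · refine Set.eq_univ_of_forall fun x => ?_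
    obtain ⟨g, hg, ⟨i, w⟩, hw, h⟩ :=
      Set.mem_smul.1 (hcov.ge (Set.mem_univ ((0, x) : Fin m × a.X)))
    exact Set.mem_smul.2 ⟨cosetCocycle e g i, cosetCocycle_mem_cosetContraction e hg i, w,
      Set.mem_iUnion.2 ⟨i, hw⟩, congrArg Prod.snd h⟩
  · rintro w₁ hw₁ w₂ hw₂ ⟨t, ht, htw⟩
    obtain ⟨i, hi⟩ := Set.mem_iUnion.1 hw₁
    obtain ⟨j, hj⟩ := Set.mem_iUnion.1 hw₂
    obtain ⟨h1, h2⟩ := exists_cosetCocycle_eq e t i j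
    refine (hconn (i, w₁) hi (j, w₂) hj ⟨cosetRep e j * t * (cosetRep e i)⁻¹, subset_symmHull
      (Finset.mem_image.2 ⟨(j, i, t), by simpa using ht, rfl⟩), ?_⟩).map
      (X := (a.induced e).X) (Prod.snd : Fin m × a.X → a.X) ?_
    · exact Prod.ext h1 (by rw [← htw]; exact congrArg (· • w₁) h2)
    · rintro ⟨i, x⟩ ⟨i', y⟩ ⟨k, ⟨g, hg, hgy⟩, hx, hy⟩
      exact ⟨k, ⟨cosetCocycle e g i, cosetCocycle_mem_cosetContraction e hg i,
        congrArg Prod.snd hgy⟩, Set.mem_iUnion.2 ⟨i, hx⟩, Set.mem_iUnion.2 ⟨i', hy⟩⟩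

end Induction

theorem mainTheorem11 (G : Type u) [Group G] [Countable G] [Infinite G]
    (H : Subgroup G) [H.FiniteIndex] :
    PropertySC.{u, v} G ↔ PropertySC.{u, v} H :=
  ⟨PropertySC.finiteIndex_subgroup H, PropertySC.of_finiteIndex_subgroup⟩
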